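/- Let $L\ge 0$ and $d\ge 0$ be integers, and let $M,K,x,\varepsilon$ be random variables on a common probability space: the payload $M$ takes values in $\{0,1\}^L$ (with an arbitrary distribution), the key $K$ takes values in a measurable space $\mathcal K$ (it may be deterministic, or random with arbitrary dependence on $M$ and $x$), the clean image $x$ takes values in $\mathbb R^d$ (with $d=3HW$ for RGB images of size $H\times W$), and $\varepsilon\sim\mathcal N(0,I_d)$ is independent of $(M,K,x)$. Assume that $x$ is independent of $M$. Let $\gamma>0$ and let $s:\{0,1\}^L\times\mathcal K\times\mathbb R^d\to\mathbb R^d$ be measurable, and consider the additively watermarked image $x_w=x+\gamma\,s(M,K,x)$. Assume that - the embedding is balanced: almost surely, $2^{-L}\sum_{m\in\{0,1\}^L}s(m,K,x)=0$, i.e. for almost every value of $(K,x)$ the signal has mean zero when the payload $m$ is drawn uniformly from $\{0,1\}^L$; - $\|s(M,K,x)\|_2^2=d$ almost surely. Let $\beta_1,\dots,\beta_{t^*}\in[0,1]$ be a noise schedule such that $\bar\alpha_{t^*}:=\prod_{r=1}^{t^*}(1-\beta_r)<1$, and let $$X_{t^*}=\sqrt{\bar\alpha_{t^*}}\,x_w+\sqrt{1-\bar\alpha_{t^*}}\,\varepsilon$$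 be the forward-noised sample. Then the mutual information (in nats, i.e. the Kullback–Leibler divergence of the joint law from the product of the marginal laws) satisfies $$I(M;X_{t^*})\le\frac d2\log\Bigl(1+\frac{\gamma^2\bar\alpha_{t^*}}{1-\bar\alpha_{t^*}}\Bigr).$$ Moreover, let $\tilde X$ be the output of an editor started from $X_{t^*}$: for an editing instruction $y$ and a Markov kernel $p_\theta(\cdot\mid\cdot,y)$ from $\mathbb R^d$ to a measurable space, the conditional law of $\tilde X$ given $(M,X_{t^*})$ is $p_\theta(\cdot\mid X_{t^*},y)$ (so that $M\to X_{t^*}\to\tilde X$ is a Markov chain). Then $I(M;\tilde X)$ is bounded by the same expression. -/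

import Mathlib

open MeasureTheory ProbabilityTheory
open scoped ENNReal

namespace Watermark

/-- Mutual information `I(X; Y)` (in nats) of two random variables under the probability measure
`P`: the Kullback-Leibler divergence of the joint law from the product of the marginal laws. -/
noncomputable def mutualInfo {Ω 𝓧 𝓨 : Type*} [MeasurableSpace Ω] [MeasurableSpace 𝓧]
    [MeasurableSpace 𝓨] (P : Measure Ω) (X : Ω → 𝓧) (Y : Ω → 𝓨) : ℝ≥0∞ :=
  InformationTheory.klDiv (P.map fun ω => (X ω, Y ω)) ((P.map X).prod (P.map Y))

/-- The space of `L`-bit payloads `{0,1}^L`. -/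
abbrev Payload (L : ℕ) : Type := Fin L → Bool

/-- The image (or latent) space `ℝ^d` with its Euclidean norm, with coordinates indexed by a finite
type `ι`, so that `d` is the cardinality of `ι`. For RGB images `ι = Fin H × Fin W × Fin 3`. -/
abbrev Image (ι : Type*) : Type _ := EuclideanSpace ℝ ι

/-- The additive watermark `x_w = x + γ s(m, k, x)`. -/
noncomputable def embed {L : ℕ} {𝓚 ι : Type*} (γ : ℝ)
    (s : Payload L → 𝓚 → Image ι → Image ι) (m : Payload L) (k : 𝓚) (x : Image ι) : Image ι :=
  x + γ • s m k x

/-- Balanced payload embedding: conditionally on the image `x` and the key `k` (that is, for almost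
every realization of them), the embedding signal averages to zero over a payload `m` that is
uniformly distributed on `{0,1}^L`. -/
def IsBalanced {Ω : Type*} [MeasurableSpace Ω] {L : ℕ} {𝓚 ι : Type*} (P : Measure Ω)
    (s : Payload L → 𝓚 → Image ι → Image ι) (K : Ω → 𝓚) (x : Ω → Image ι) : Prop :=
  ∀ᵐ ω ∂P, ((2 : ℝ) ^ L)⁻¹ • ∑ m : Payload L, s m (K ω) (x ω) = 0

/-- The cumulative signal coefficient `ᾱ_t = ∏_{r=1}^t (1 - β_r)` of a noise schedule `β`. -/
noncomputable def alphaBar (β : ℕ → ℝ) (t : ℕ) : ℝ := ∏ r ∈ Finset.Icc 1 t, (1 - β r)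

/-- The forward noising map `x_t = √ᾱ_t x₀ + √(1 - ᾱ_t) ε`. -/
noncomputable def forwardNoise {ι : Type*} (β : ℕ → ℝ) (t : ℕ) (x₀ ε : Image ι) : Image ι :=
  √(alphaBar β t) • x₀ + √(1 - alphaBar β t) • ε

/-- `Xout` is the output of an editor with reverse conditional distribution `R = p_θ(· | ·, y)`
started from `Xt`: given `(M, Xt)`, the law of `Xout` is `R (Xt)`, whatever the value of the
payload `M`. This is the Markov property at `Xt` of the chain `M → Xt → Xout`. -/
def IsEditorOutput {Ω 𝓜 𝓧 𝓞 : Type*} [MeasurableSpace Ω] [MeasurableSpace 𝓜] [MeasurableSpace 𝓧]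
    [MeasurableSpace 𝓞] (P : Measure Ω) (M : Ω → 𝓜) (Xt : Ω → 𝓧) (R : Kernel 𝓧 𝓞)
    (Xout : Ω → 𝓞) : Prop :=
  HasCondDistrib Xout (fun ω => (M ω, Xt ω)) (Kernel.prodMkLeft 𝓜 R) P

end Watermark

/-! Write `a` for `ᾱ_t`. For any probability measure `Q`, `I(M; X_t)` is at most the divergence of
the joint law from `P_M ⊗ Q` (`mutualInfo_le_klDiv_prod`). Take `Q` to be the law of `√a x + τ w`,
with `w` standard Gaussian independent of `x` and `τ² = 1 - a + γ² a`. As `x` is independent of `M`,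
both measures are images, under the map that forgets the key and adds `√a x`, of laws on `(M, K, x)`
paired with `√a γ s + √(1 - a) ε`, respectively with an independent `τ w`
(`map_prod_noise_eq_prod`). Data processing leaves a Gaussian divergence that is computed exactly
(`klDiv_channel`). The clean image thus costs nothing, and only the power of `s` matters. The editor
adds one more data-processing step. -/

namespace Watermark

/-! ### Variational bound and data processing for divergences. -/

section Information

open InformationTheory

/-- Replacing the second marginal by an arbitrary probability measure can only increase the
divergence from the product measure. -/
theorem mutualInfo_le_klDiv_prod {Ω 𝓧 𝓨 : Type*} [MeasurableSpace Ω] [MeasurableSpace 𝓧]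
    [StandardBorelSpace 𝓧] [Nonempty 𝓧] [MeasurableSpace 𝓨] (P : Measure Ω)
    [IsProbabilityMeasure P] {X : Ω → 𝓧} {Y : Ω → 𝓨} (hX : Measurable X) (hY : Measurable Y)
    (Q : Measure 𝓨) [IsProbabilityMeasure Q] :
    mutualInfo P X Y ≤ klDiv (P.map fun ω => (X ω, Y ω)) ((P.map X).prod Q) := by
  have := Measure.isProbabilityMeasure_map (μ := P) hX.aemeasurable
  have := Measure.isProbabilityMeasure_map (μ := P) hY.aemeasurable
  have hjoint : (P.map fun ω => (X ω, Y ω)).map Prod.swap = P.map Y ⊗ₘ condDistrib X Y P := by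
    rw [compProd_map_condDistrib hX.aemeasurable,
      Measure.map_map measurable_swap (hX.prodMk hY)]
    rfl
  have hback : (P.map Y ⊗ₘ condDistrib X Y P).map Prod.swap = P.map fun ω => (X ω, Y ω) := by
    rw [← hjoint, Measure.map_map measurable_swap measurable_swap]
    simp
  calc mutualInfo P X Y
      = klDiv ((P.map Y ⊗ₘ condDistrib X Y P).map Prod.swap)
          ((P.map Y ⊗ₘ Kernel.const 𝓨 (P.map X)).map Prod.swap) := by
        rw [hback, Measure.compProd_const, Measure.prod_swap, mutualInfo]
    _ ≤ klDiv (P.map Y ⊗ₘ condDistrib X Y P) (P.map Y ⊗ₘ Kernel.const 𝓨 (P.map X)) :=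
        klDiv_map_le _ _ measurable_swap
    -- By the chain rule the two sides differ by `klDiv (P.map Y) Q ≥ 0`; the swaps serve to make
    -- `Y` the base of the disintegration.
    _ ≤ klDiv (P.map Y ⊗ₘ condDistrib X Y P) (Q ⊗ₘ Kernel.const 𝓨 (P.map X)) := by
        rw [klDiv_compProd_eq_add _ Q]
        exact le_add_self
    _ = klDiv ((P.map fun ω => (X ω, Y ω)).map Prod.swap)
          (((P.map X).prod Q).map Prod.swap) := by
        rw [hjoint, Measure.compProd_const, Measure.prod_swap]
    _ ≤ _ := klDiv_map_le _ _ measurable_swap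

/-- Data processing inequality along a Markov chain `M → Xt → Xout`. -/
theorem mutualInfo_editorOutput_le {Ω 𝓜 𝓧 𝓞 : Type*} [MeasurableSpace Ω] [MeasurableSpace 𝓜]
    [MeasurableSpace 𝓧] [MeasurableSpace 𝓞] (P : Measure Ω) [IsProbabilityMeasure P]
    {M : Ω → 𝓜} {Xt : Ω → 𝓧} (hM : Measurable M) (hXt : Measurable Xt) (R : Kernel 𝓧 𝓞)
    [IsMarkovKernel R] {Xout : Ω → 𝓞} (h : IsEditorOutput P M Xt R Xout) :
    mutualInfo P M Xout ≤ mutualInfo P M Xt := by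
  have := Measure.isProbabilityMeasure_map (μ := P) hM.aemeasurable
  have := Measure.isProbabilityMeasure_map (μ := P) hXt.aemeasurable
  have := Measure.isProbabilityMeasure_map (μ := P) (hM.prodMk hXt).aemeasurable
  have hout : AEMeasurable Xout P := HasCondDistrib.aemeasurable_snd h
  have := Measure.isProbabilityMeasure_map (μ := P) hout
  have hlaw := h.map_eq
  have hg : Measurable fun p : (𝓜 × 𝓧) × 𝓞 => (p.1.1, p.2) := by fun_prop
  have hjoint : (P.map (fun ω => (M ω, Xt ω)) ⊗ₘ Kernel.prodMkLeft 𝓜 R).map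
      (fun p => (p.1.1, p.2)) = P.map fun ω => (M ω, Xout ω) := by
    rw [← hlaw, AEMeasurable.map_map_of_aemeasurable hg.aemeasurable h.aemeasurable]
    rfl
  have hmarg : ∀ B, MeasurableSet B → P.map Xout B = ∫⁻ x, R x B ∂P.map Xt := by
    intro B hB
    have : P.map Xout = (P.map (fun ω => (M ω, Xt ω)) ⊗ₘ Kernel.prodMkLeft 𝓜 R).map Prod.snd := by
      rw [← hlaw, AEMeasurable.map_map_of_aemeasurable measurable_snd.aemeasurable h.aemeasurable]
      rfl
    rw [this, Measure.map_apply measurable_snd hB, Measure.compProd_apply (measurable_snd hB),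
      lintegral_map (Kernel.measurable_kernel_prodMk_left (measurable_snd hB)) (hM.prodMk hXt),
      lintegral_map (R.measurable_coe hB) hXt]
    rfl
  -- `R` ignores the payload, so it sends a product law to a product law.
  have hprod : ((P.map M).prod (P.map Xt) ⊗ₘ Kernel.prodMkLeft 𝓜 R).map (fun p => (p.1.1, p.2))
      = (P.map M).prod (P.map Xout) := by
    refine (Measure.prod_eq fun A B hA hB => ?_).symm
    have hAB := hg (hA.prod hB)
    rw [Measure.map_apply hg (hA.prod hB), Measure.compProd_apply hAB,
      lintegral_prod _ (Kernel.measurable_kernel_prodMk_left hAB).aemeasurable, hmarg B hB,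
      ← lintegral_indicator_one hA, ← lintegral_mul_const _ (measurable_one.indicator hA)]
    refine lintegral_congr fun m => ?_
    by_cases hm : m ∈ A
    · simp only [hm, Set.indicator_of_mem, Pi.one_apply, one_mul]
      refine lintegral_congr fun x => ?_
      simp [Kernel.prodMkLeft_apply, Set.preimage, hm]
    · simp [Set.preimage, hm]
  calc mutualInfo P M Xout
      = klDiv ((P.map (fun ω => (M ω, Xt ω)) ⊗ₘ Kernel.prodMkLeft 𝓜 R).map (fun p => (p.1.1, p.2)))
          (((P.map M).prod (P.map Xt) ⊗ₘ Kernel.prodMkLeft 𝓜 R).map (fun p => (p.1.1, p.2))) := by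
        rw [hjoint, hprod, mutualInfo]
    _ ≤ klDiv (P.map (fun ω => (M ω, Xt ω)) ⊗ₘ Kernel.prodMkLeft 𝓜 R)
          ((P.map M).prod (P.map Xt) ⊗ₘ Kernel.prodMkLeft 𝓜 R) := klDiv_map_le _ _ hg
    -- Adjoining the same Markov kernel to both measures leaves the divergence unchanged.
    _ = mutualInfo P M Xt := by rw [klDiv_compProd_left, mutualInfo]

/-- The divergence of a measure given by an explicit positive density is the integral of the
logarithm of that density. -/
theorem klDiv_withDensity_exp {α : Type*} [MeasurableSpace α] {μ ν : Measure α}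
    [IsProbabilityMeasure μ] [IsProbabilityMeasure ν] {f : α → ℝ} (hf : Measurable f)
    (hμ : μ = ν.withDensity fun a => ENNReal.ofReal (Real.exp (f a))) (hint : Integrable f μ) :
    klDiv μ ν = ENNReal.ofReal (∫ a, f a ∂μ) := by
  have hac : μ ≪ ν := hμ ▸ withDensity_absolutelyContinuous _ _
  have hllr : llr μ ν =ᵐ[μ] f := by
    have h : μ.rnDeriv ν =ᵐ[ν] fun a => ENNReal.ofReal (Real.exp (f a)) := by
      rw [hμ]
      exact Measure.rnDeriv_withDensity _ (by fun_prop)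
    filter_upwards [hac.ae_le h] with a ha
    rw [llr, ha, ENNReal.toReal_ofReal (Real.exp_pos _).le, Real.log_exp]
  rw [klDiv_of_ac_of_integrable hac (hint.congr hllr.symm), integral_congr_ae hllr]
  simp

end Information

/-! ### Density and second moment of isotropic Gaussians. -/

section GaussianDensity

open Module

variable {E : Type*} [NormedAddCommGroup E] [InnerProductSpace ℝ E]
  [MeasurableSpace E] [BorelSpace E]

/-- The logarithm of the density of the centered Gaussian with covariance `c² I`. -/
noncomputable def logGaussianDensity (E : Type*) [NormedAddCommGroup E] [InnerProductSpace ℝ E]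
    (c : ℝ) (w : E) : ℝ :=
  -(2 * c ^ 2)⁻¹ * ‖w‖ ^ 2 - finrank ℝ E / 2 * Real.log (2 * Real.pi * c ^ 2)

@[fun_prop]
theorem measurable_logGaussianDensity (c : ℝ) : Measurable (logGaussianDensity E c) := by
  unfold logGaussianDensity
  fun_prop

variable [FiniteDimensional ℝ E]

/-- Both sides have the same characteristic function, by the Fourier transform of `exp (-b ‖w‖²)`
with `b = 1 / (2c²)`. -/
theorem map_smul_stdGaussian {c : ℝ} (hc : 0 < c) :
    (stdGaussian E).map (fun w => c • w) =
      volume.withDensity fun w => ENNReal.ofReal (Real.exp (logGaussianDensity E c w)) := by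
  have hb : 0 < (2 * c ^ 2)⁻¹ := by positivity
  have hb' : 0 < (((2 * c ^ 2)⁻¹ : ℝ) : ℂ).re := by rw [Complex.ofReal_re]; exact hb
  set K : ℝ := finrank ℝ E / 2 * Real.log (2 * Real.pi * c ^ 2) with hK
  have hint : Integrable (fun w => Real.exp (logGaussianDensity E c w)) := by
    have h := (GaussianFourier.integrable_cexp_neg_mul_sq_norm_add (V := E) hb' 0 0).re
    refine (h.const_mul (Real.exp (-K))).congr (Filter.Eventually.of_forall fun w => ?_)
    have : (-(((2 * c ^ 2)⁻¹ : ℝ) : ℂ) * (‖w‖ : ℂ) ^ 2 + 0 * ((inner ℝ (0 : E) w : ℝ) : ℂ)) =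
        ((-(2 * c ^ 2)⁻¹ * ‖w‖ ^ 2 : ℝ) : ℂ) := by push_cast; ring
    simp only [this, ← Complex.ofReal_exp, logGaussianDensity, ← hK]
    simp only [RCLike.re_to_complex, Complex.ofReal_re, ← Real.exp_add]
    congr 1; ring
  have : IsFiniteMeasure (volume.withDensity fun w : E =>
      ENNReal.ofReal (Real.exp (logGaussianDensity E c w))) :=
    isFiniteMeasure_withDensity_ofReal hint.2
  have := Measure.isProbabilityMeasure_map (μ := stdGaussian E)
    (f := fun w => c • w) (by fun_prop)
  refine Measure.ext_of_charFun (funext fun t => ?_)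
  rw [charFun_map_smul, charFun_stdGaussian, charFun_apply,
    integral_withDensity_eq_integral_toReal_smul (by fun_prop) (by simp)]
  have hpt : ∀ w : E, (ENNReal.ofReal (Real.exp (logGaussianDensity E c w))).toReal •
      Complex.exp ((inner ℝ w t : ℝ) * Complex.I) = Complex.exp (-(K : ℂ)) *
      Complex.exp (-(((2 * c ^ 2)⁻¹ : ℝ) : ℂ) * (‖w‖ : ℂ) ^ 2 +
        Complex.I * ((inner ℝ t w : ℝ) : ℂ)) := by
    intro w
    rw [ENNReal.toReal_ofReal (Real.exp_pos _).le, Complex.real_smul, Complex.ofReal_exp,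
      ← Complex.exp_add, ← Complex.exp_add, logGaussianDensity, ← hK, real_inner_comm]
    congr 1; push_cast; ring
  simp_rw [hpt]
  rw [integral_const_mul, GaussianFourier.integral_cexp_neg_mul_sq_norm_add hb']
  -- The Fourier prefactor `(π / b)^(d/2)` is exactly the normalizing constant `(2πc²)^(d/2)`.
  have hpow : ((Real.pi : ℂ) / (((2 * c ^ 2)⁻¹ : ℝ) : ℂ)) ^ ((finrank ℝ E : ℂ) / 2) =
      Complex.exp (K : ℂ) := by
    have h2 : (Real.pi : ℂ) / (((2 * c ^ 2)⁻¹ : ℝ) : ℂ) = ((2 * Real.pi * c ^ 2 : ℝ) : ℂ) := by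
      push_cast; field_simp
    have h3 : ((finrank ℝ E : ℂ) / 2) = ((finrank ℝ E / 2 : ℝ) : ℂ) := by push_cast; ring
    rw [h2, h3, ← Complex.ofReal_cpow (by positivity), Real.rpow_def_of_pos (by positivity),
      Complex.ofReal_exp, hK, mul_comm]
  rw [hpow, ← mul_assoc, ← Complex.exp_add]
  simp only [neg_add_cancel, Complex.exp_zero, one_mul]
  congr 1
  rw [norm_smul, Real.norm_of_nonneg hc.le, Complex.I_sq]
  have : (c : ℂ) ≠ 0 := by exact_mod_cast hc.ne'
  push_cast
  field_simp
  ring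

theorem memLp_two_stdGaussian : MemLp (fun w : E => w) 2 (stdGaussian E) :=
  IsGaussian.memLp_two_id

theorem integral_norm_sq_stdGaussian :
    ∫ w, ‖w‖ ^ 2 ∂stdGaussian E = finrank ℝ E := by
  have hsum : ∀ w : E, ‖w‖ ^ 2 = ∑ i, (inner ℝ (stdOrthonormalBasis ℝ E i) w : ℝ) ^ 2 :=
    fun w => ((stdOrthonormalBasis ℝ E).sum_sq_inner_right w).symm
  have hL : ∀ i, MemLp (fun w : E => (inner ℝ (stdOrthonormalBasis ℝ E i) w : ℝ)) 2
      (stdGaussian E) := fun i => memLp_two_stdGaussian.const_inner _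
  simp_rw [hsum]
  rw [integral_finsetSum _ fun i _ => (hL i).integrable_sq]
  have h1 : ∀ i, ∫ w, (inner ℝ (stdOrthonormalBasis ℝ E i) w : ℝ) ^ 2 ∂stdGaussian E = 1 := by
    intro i
    have hv := variance_dual_stdGaussian (innerSL ℝ (stdOrthonormalBasis ℝ E i))
    have hm := integral_strongDual_stdGaussian (innerSL ℝ (stdOrthonormalBasis ℝ E i))
    rw [variance_of_integral_eq_zero (by fun_prop) hm] at hv
    simpa using hv
  simp [h1]

end GaussianDensity

/-! ### Exact divergence for the Gaussian channel. -/

section GaussianChannel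

open Module InformationTheory

variable {Ω 𝓩 E : Type*} [MeasurableSpace Ω] [MeasurableSpace 𝓩] [NormedAddCommGroup E]
  [InnerProductSpace ℝ E] [FiniteDimensional ℝ E] [MeasurableSpace E] [BorelSpace E]
  {P : Measure Ω} [IsProbabilityMeasure P] {Z : Ω → 𝓩} {S : 𝓩 → E} {ε : Ω → E}

/-- Given `Z = z` the output is Gaussian centered at `S z`; the exponent is its log-likelihood ratio
against the reference of scale `τ`. -/
theorem map_channel_eq_withDensity (hZ : Measurable Z) (hS : Measurable S) (hε : Measurable ε)
    (hlaw : HasLaw ε (stdGaussian E) P) (hind : IndepFun ε Z P) {σ τ : ℝ} (hσ : 0 < σ)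
    (hτ : 0 < τ) :
    P.map (fun ω => (Z ω, S (Z ω) + σ • ε ω)) =
      ((P.map Z).prod ((stdGaussian E).map fun w => τ • w)).withDensity fun p =>
        ENNReal.ofReal (Real.exp
          (logGaussianDensity E σ (p.2 - S p.1) - logGaussianDensity E τ p.2)) := by
  have := Measure.isProbabilityMeasure_map (μ := P) hZ.aemeasurable
  have hshear : Measurable fun p : 𝓩 × E => (p.1, S p.1 + σ • p.2) := by fun_prop
  have hjoint : P.map (fun ω => (Z ω, ε ω)) = (P.map Z).prod (stdGaussian E) := by
    rw [(indepFun_iff_map_prod_eq_prod_map_map hZ.aemeasurable hε.aemeasurable).1 hind.symm,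
      hlaw.map_eq]
  have hmap : P.map (fun ω => (Z ω, S (Z ω) + σ • ε ω)) =
      ((P.map Z).prod (stdGaussian E)).map fun p => (p.1, S p.1 + σ • p.2) := by
    rw [← hjoint, Measure.map_map hshear (hZ.prodMk hε)]
    rfl
  ext A hA
  rw [hmap, Measure.map_apply hshear hA, Measure.prod_apply (hshear hA),
    withDensity_apply _ hA, ← lintegral_indicator hA,
    lintegral_prod _ (Measurable.aemeasurable (Measurable.indicator (by fun_prop) hA))]
  refine lintegral_congr fun z => ?_
  have hAz : MeasurableSet (Prod.mk z ⁻¹' A) := measurable_prodMk_left hA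
  have hAz' : MeasurableSet ((fun w => S z + w) ⁻¹' (Prod.mk z ⁻¹' A)) :=
    measurable_const_add (S z) hAz
  have hl : stdGaussian E (Prod.mk z ⁻¹' ((fun p : 𝓩 × E => (p.1, S p.1 + σ • p.2)) ⁻¹' A)) =
      (stdGaussian E).map (fun w => σ • w) ((fun w => S z + w) ⁻¹' (Prod.mk z ⁻¹' A)) := by
    rw [Measure.map_apply (by fun_prop) hAz']
    rfl
  have hmeas : Measurable fun w => A.indicator (fun p : 𝓩 × E => ENNReal.ofReal (Real.exp
      (logGaussianDensity E σ (p.2 - S p.1) - logGaussianDensity E τ p.2))) (z, w) :=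
    (Measurable.indicator (by fun_prop) hA).comp measurable_prodMk_left
  rw [hl, map_smul_stdGaussian hσ, map_smul_stdGaussian hτ, withDensity_apply _ hAz',
    lintegral_withDensity_eq_lintegral_mul _ (by fun_prop) hmeas,
    ← lintegral_indicator hAz']
  -- Translation invariance of volume recenters the noise at `S z`.
  rw [← lintegral_sub_right_eq_self _ (S z)]
  refine lintegral_congr fun w => ?_
  by_cases hw : (z, w) ∈ A
  · simp only [Set.indicator, Set.mem_preimage, Pi.mul_apply, add_sub_cancel, hw, if_true]
    rw [← ENNReal.ofReal_mul (Real.exp_pos _).le, ← Real.exp_add]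
    congr 2; ring
  · simp [Set.indicator, hw]

theorem integral_inner_eq_zero_of_indepFun (hZ : Measurable Z) (hS : Measurable S)
    (hε : Measurable ε) (hlaw : HasLaw ε (stdGaussian E) P) (hind : IndepFun ε Z P)
    (hint : Integrable (fun ω => (inner ℝ (S (Z ω)) (ε ω) : ℝ)) P) :
    ∫ ω, (inner ℝ (S (Z ω)) (ε ω) : ℝ) ∂P = 0 := by
  have := Measure.isProbabilityMeasure_map (μ := P) hZ.aemeasurable
  have hjoint : P.map (fun ω => (Z ω, ε ω)) = (P.map Z).prod (stdGaussian E) := by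
    rw [(indepFun_iff_map_prod_eq_prod_map_map hZ.aemeasurable hε.aemeasurable).1 hind.symm,
      hlaw.map_eq]
  have hm : Measurable fun p : 𝓩 × E => (inner ℝ (S p.1) p.2 : ℝ) := by fun_prop
  have hZε : AEMeasurable (fun ω => (Z ω, ε ω)) P := (hZ.prodMk hε).aemeasurable
  have hint' : Integrable (fun p : 𝓩 × E => (inner ℝ (S p.1) p.2 : ℝ))
      ((P.map Z).prod (stdGaussian E)) := by
    rw [← hjoint, integrable_map_measure hm.aestronglyMeasurable hZε]
    exact hint
  have h := integral_map hZε (f := fun p : 𝓩 × E => (inner ℝ (S p.1) p.2 : ℝ))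
    hm.aestronglyMeasurable
  rw [← h, hjoint, integral_prod _ hint']
  have h0 : ∀ z, ∫ w, (inner ℝ (S z) w : ℝ) ∂stdGaussian E = 0 := fun z =>
    integral_strongDual_stdGaussian (innerSL ℝ (S z))
  simp [h0]

/-- Divergence of the output of a Gaussian channel with constant input power from an independent
centered Gaussian. -/
theorem klDiv_channel (hZ : Measurable Z) (hS : Measurable S) (hε : Measurable ε)
    (hlaw : HasLaw ε (stdGaussian E) P) (hind : IndepFun ε Z P) {σ τ c : ℝ} (hσ : 0 < σ)
    (hτ : 0 < τ) (hpow : ∀ᵐ ω ∂P, ‖S (Z ω)‖ ^ 2 = c) :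
    klDiv (P.map fun ω => (Z ω, S (Z ω) + σ • ε ω))
        ((P.map Z).prod ((stdGaussian E).map fun w => τ • w)) =
      ENNReal.ofReal (finrank ℝ E / 2 * Real.log (τ ^ 2 / σ ^ 2) - finrank ℝ E / 2 +
        (c + finrank ℝ E * σ ^ 2) / (2 * τ ^ 2)) := by
  have := Measure.isProbabilityMeasure_map (μ := P) hZ.aemeasurable
  have := Measure.isProbabilityMeasure_map (μ := stdGaussian E) (f := fun w => τ • w)
    (by fun_prop)
  have hmeas : Measurable fun ω => (Z ω, S (Z ω) + σ • ε ω) := by fun_prop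
  have := Measure.isProbabilityMeasure_map (μ := P) hmeas.aemeasurable
  have hf : Measurable fun p : 𝓩 × E =>
      logGaussianDensity E σ (p.2 - S p.1) - logGaussianDensity E τ p.2 := by fun_prop
  have hsq : Integrable (fun ω => ‖ε ω‖ ^ 2) P := by
    have h := (memLp_two_stdGaussian (E := E)).integrable_norm_pow two_ne_zero
    rw [← hlaw.map_eq, integrable_map_measure (by fun_prop) hε.aemeasurable] at h
    exact h
  have hsqint : ∫ ω, ‖ε ω‖ ^ 2 ∂P = finrank ℝ E := by
    rw [← integral_norm_sq_stdGaussian (E := E), ← hlaw.map_eq,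
      integral_map hε.aemeasurable (by fun_prop)]
  -- Cauchy–Schwarz and AM-GM give the dominating function `c + ‖ε‖²`.
  have hcross : Integrable (fun ω => (inner ℝ (S (Z ω)) (ε ω) : ℝ)) P := by
    refine ((integrable_const c).add hsq).mono' (by fun_prop) ?_
    filter_upwards [hpow] with ω hω
    refine (norm_inner_le_norm _ _).trans ?_
    simp only [Pi.add_apply, ← hω]
    nlinarith [sq_nonneg (‖S (Z ω)‖ - ‖ε ω‖), sq_nonneg ‖S (Z ω)‖, sq_nonneg ‖ε ω‖]
  -- Expanding `‖S + σε‖²` with `‖S‖² = c` leaves randomness only in `‖ε‖²` and in a cross term of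
  -- mean zero.
  have hpt : (fun ω => logGaussianDensity E σ (S (Z ω) + σ • ε ω - S (Z ω)) -
      logGaussianDensity E τ (S (Z ω) + σ • ε ω)) =ᵐ[P] fun ω =>
        (finrank ℝ E / 2 * Real.log (τ ^ 2 / σ ^ 2) + c / (2 * τ ^ 2)) +
        ((σ ^ 2 / (2 * τ ^ 2) - 1 / 2) * ‖ε ω‖ ^ 2 +
          (σ / τ ^ 2) * (inner ℝ (S (Z ω)) (ε ω) : ℝ)) := by
    filter_upwards [hpow] with ω hω
    have hlog : Real.log (τ ^ 2 / σ ^ 2) =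
        Real.log (2 * Real.pi * τ ^ 2) - Real.log (2 * Real.pi * σ ^ 2) := by
      rw [← Real.log_div (by positivity) (by positivity)]
      congr 1; field_simp
    rw [add_sub_cancel_left, logGaussianDensity, logGaussianDensity, norm_add_sq_real, hω, hlog,
      norm_smul, Real.norm_of_nonneg hσ.le, inner_smul_right]
    field_simp
    ring
  have hrand : Integrable (fun ω => (σ ^ 2 / (2 * τ ^ 2) - 1 / 2) * ‖ε ω‖ ^ 2 +
      (σ / τ ^ 2) * (inner ℝ (S (Z ω)) (ε ω) : ℝ)) P :=
    (hsq.const_mul _).add (hcross.const_mul _)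
  rw [klDiv_withDensity_exp hf (map_channel_eq_withDensity hZ hS hε hlaw hind hσ hτ),
    integral_map hmeas.aemeasurable hf.aestronglyMeasurable, integral_congr_ae hpt,
    integral_add (integrable_const _) hrand,
    integral_add (hsq.const_mul _) (hcross.const_mul _), integral_const_mul, integral_const_mul,
    hsqint, integral_inner_eq_zero_of_indepFun hZ hS hε hlaw hind hcross]
  · congr 1
    simp
    field_simp
    ring
  · rw [integrable_map_measure hf.aestronglyMeasurable hmeas.aemeasurable]
    exact ((integrable_const _).add hrand).congr hpt.symm

end GaussianChannel

/-! ### Application to the noised watermark. -/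

theorem alphaBar_nonneg {β : ℕ → ℝ} {t : ℕ} (hβ : ∀ r ∈ Finset.Icc 1 t, β r ∈ Set.Icc (0 : ℝ) 1) :
    0 ≤ alphaBar β t :=
  Finset.prod_nonneg fun r hr => sub_nonneg.2 (hβ r hr).2

/-- If `X` is independent of `M`, then any function of `X` and independent noise is
independent of `M`. -/
theorem map_prod_noise_eq_prod {Ω 𝓜 𝓚 E : Type*} [MeasurableSpace Ω] [MeasurableSpace 𝓜]
    [MeasurableSpace 𝓚] [MeasurableSpace E] {P : Measure Ω} [IsProbabilityMeasure P]
    {M : Ω → 𝓜} {K : Ω → 𝓚} {X : Ω → E} (hM : Measurable M) (hK : Measurable K)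
    (hX : Measurable X) (hind : IndepFun X M P) (ν : Measure E) [IsProbabilityMeasure ν]
    {g : E × E → E} (hg : Measurable g) :
    ((P.map fun ω => (M ω, K ω, X ω)).prod ν).map (fun p => (p.1.1, g (p.1.2.2, p.2))) =
      (P.map M).prod (((P.map X).prod ν).map g) := by
  have := Measure.isProbabilityMeasure_map (μ := P) hM.aemeasurable
  have := Measure.isProbabilityMeasure_map (μ := P) hX.aemeasurable
  have hZ : Measurable fun ω => (M ω, K ω, X ω) := hM.prodMk (hK.prodMk hX)
  have := Measure.isProbabilityMeasure_map (μ := P) hZ.aemeasurable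
  have hπ : Measurable fun z : 𝓜 × 𝓚 × E => (z.1, z.2.2) := by fun_prop
  have hMX : (P.map fun ω => (M ω, K ω, X ω)).map (fun z => (z.1, z.2.2)) =
      (P.map M).prod (P.map X) := by
    rw [Measure.map_map hπ hZ,
      ← (indepFun_iff_map_prod_eq_prod_map_map hM.aemeasurable hX.aemeasurable).1 hind.symm]
    rfl
  have hfac : (fun p : (𝓜 × 𝓚 × E) × E => (p.1.1, g (p.1.2.2, p.2))) =
      Prod.map id g ∘ MeasurableEquiv.prodAssoc ∘
        Prod.map (fun z : 𝓜 × 𝓚 × E => (z.1, z.2.2)) id := rfl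
  rw [hfac, ← Measure.map_map (by fun_prop) (by fun_prop),
    ← Measure.map_map (by fun_prop) (by fun_prop), ← Measure.map_prod_map _ _ hπ measurable_id,
    hMX, Measure.map_id, Measure.prodAssoc_prod, ← Measure.map_prod_map _ _ measurable_id hg,
    Measure.map_id]

open InformationTheory in
/-- Mutual information between the payload and the forward-noised watermarked image. -/
theorem mutualInfo_forwardNoise_le {Ω 𝓚 ι : Type*} [MeasurableSpace Ω]
    [MeasurableSpace 𝓚] [Fintype ι] {P : Measure Ω} [IsProbabilityMeasure P] {L : ℕ}
    {s : Payload L → 𝓚 → Image ι → Image ι}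
    (hs : Measurable fun p : Payload L × 𝓚 × Image ι => s p.1 p.2.1 p.2.2) (γ : ℝ)
    {β : ℕ → ℝ} {t : ℕ} (hβ : ∀ r ∈ Finset.Icc 1 t, β r ∈ Set.Icc (0 : ℝ) 1)
    (hα : alphaBar β t < 1) {M : Ω → Payload L} (hM : Measurable M) {K : Ω → 𝓚}
    (hK : Measurable K) {x : Ω → Image ι} (hx : Measurable x) {ε : Ω → Image ι}
    (hε : Measurable ε) (hεlaw : HasLaw ε (stdGaussian (Image ι)) P)
    (hεindep : IndepFun ε (fun ω => (M ω, K ω, x ω)) P) (hMx : IndepFun x M P)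
    (hnorm : ∀ᵐ ω ∂P, ‖s (M ω) (K ω) (x ω)‖ ^ 2 = (Fintype.card ι : ℝ)) :
    mutualInfo P M (fun ω => forwardNoise β t (embed γ s (M ω) (K ω) (x ω)) (ε ω)) ≤
      ENNReal.ofReal ((Fintype.card ι : ℝ) / 2 *
        Real.log (1 + γ ^ 2 * alphaBar β t / (1 - alphaBar β t))) := by
  have ha := alphaBar_nonneg hβ
  set a := alphaBar β t with ha_def
  have h1a : 0 < 1 - a := sub_pos.2 hα
  have hv : 0 < 1 - a + γ ^ 2 * a := by positivity
  set σ := √(1 - a) with hσ_def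
  -- `τ²` is the mean power per coordinate of signal plus noise, so that `c + dσ² = dτ²` and only
  -- the logarithm survives in `klDiv_channel`.
  set τ := √(1 - a + γ ^ 2 * a) with hτ_def
  have hσ : 0 < σ := Real.sqrt_pos.2 h1a
  have hτ : 0 < τ := Real.sqrt_pos.2 hv
  have hσ2 : σ ^ 2 = 1 - a := Real.sq_sqrt h1a.le
  have hτ2 : τ ^ 2 = 1 - a + γ ^ 2 * a := Real.sq_sqrt hv.le
  let Z : Ω → Payload L × 𝓚 × Image ι := fun ω => (M ω, K ω, x ω)
  have hZ : Measurable Z := hM.prodMk (hK.prodMk hx)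
  let S : Payload L × 𝓚 × Image ι → Image ι := fun z => (√a * γ) • s z.1 z.2.1 z.2.2
  have hS : Measurable S := (measurable_const_smul (√a * γ)).comp hs
  have hpow : ∀ᵐ ω ∂P, ‖S (Z ω)‖ ^ 2 = γ ^ 2 * a * Fintype.card ι := by
    filter_upwards [hnorm] with ω hω
    simp only [S, Z, norm_smul, mul_pow, hω, Real.norm_eq_abs, sq_abs, Real.sq_sqrt ha]
    ring
  let ν : Measure (Image ι) := (stdGaussian (Image ι)).map fun w => τ • w
  have : IsProbabilityMeasure ν := Measure.isProbabilityMeasure_map (by fun_prop)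
  let g : Image ι × Image ι → Image ι := fun q => √a • q.1 + q.2
  have hg : Measurable g := by fun_prop
  have := Measure.isProbabilityMeasure_map (μ := P) hx.aemeasurable
  have : IsProbabilityMeasure (((P.map x).prod ν).map g) :=
    Measure.isProbabilityMeasure_map hg.aemeasurable
  -- `G` discards the key and adds back `√a x`; it maps both channel laws to the laws being
  -- compared.
  let G : (Payload L × 𝓚 × Image ι) × Image ι → Payload L × Image ι :=
    fun p => (p.1.1, g (p.1.2.2, p.2))
  have hG : Measurable G := by fun_prop
  have hchan : Measurable fun ω => (Z ω, S (Z ω) + σ • ε ω) := by fun_prop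
  have hXt : (fun ω => forwardNoise β t (embed γ s (M ω) (K ω) (x ω)) (ε ω)) =
      fun ω => g (x ω, S (Z ω) + σ • ε ω) := by
    funext ω
    simp only [forwardNoise, embed, g, S, Z, ← ha_def, ← hσ_def, smul_add, smul_smul, add_assoc]
  have hY : Measurable fun ω => g (x ω, S (Z ω) + σ • ε ω) := by fun_prop
  rw [hXt]
  calc mutualInfo P M (fun ω => g (x ω, S (Z ω) + σ • ε ω))
      ≤ klDiv (P.map fun ω => (M ω, g (x ω, S (Z ω) + σ • ε ω)))
          ((P.map M).prod (((P.map x).prod ν).map g)) := mutualInfo_le_klDiv_prod P hM hY _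
    _ = klDiv ((P.map fun ω => (Z ω, S (Z ω) + σ • ε ω)).map G) (((P.map Z).prod ν).map G) := by
        rw [Measure.map_map hG hchan, map_prod_noise_eq_prod hM hK hx hMx ν hg]
        rfl
    _ ≤ klDiv (P.map fun ω => (Z ω, S (Z ω) + σ • ε ω)) ((P.map Z).prod ν) :=
        klDiv_map_le _ _ hG
    _ = _ := by
        rw [klDiv_channel hZ hS hε hεlaw hεindep hσ hτ hpow, finrank_euclideanSpace, hσ2, hτ2]
        have hlog : (1 - a + γ ^ 2 * a) / (1 - a) = 1 + γ ^ 2 * a / (1 - a) := by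
          field_simp
        rw [hlog]
        congr 1
        field_simp
        ring

end Watermark

theorem mainTheorem1
    {Ω 𝓚 𝓨 𝓞 ι : Type*} [MeasurableSpace Ω] [MeasurableSpace 𝓚] [MeasurableSpace 𝓞] [Fintype ι]
    (P : Measure Ω) [IsProbabilityMeasure P] (L : ℕ)
    -- the embedding signal and its strength
    (s : Watermark.Payload L → 𝓚 → Watermark.Image ι → Watermark.Image ι)
    (hs : Measurable fun p : Watermark.Payload L × 𝓚 × Watermark.Image ι => s p.1 p.2.1 p.2.2)
    (γ : ℝ) (hγ : 0 < γ)
    -- the noise schedule and the start time of the editor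
    (β : ℕ → ℝ) (t : ℕ) (hβ : ∀ r ∈ Finset.Icc 1 t, β r ∈ Set.Icc (0 : ℝ) 1)
    (hα : Watermark.alphaBar β t < 1)
    -- payload, key, clean image, Gaussian noise
    (M : Ω → Watermark.Payload L) (hM : Measurable M)
    (K : Ω → 𝓚) (hK : Measurable K)
    (x : Ω → Watermark.Image ι) (hx : Measurable x)
    (ε : Ω → Watermark.Image ι) (hε : Measurable ε)
    (hεlaw : HasLaw ε (stdGaussian (Watermark.Image ι)) P)
    (hεindep : IndepFun ε (fun ω => (M ω, K ω, x ω)) P)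
    (hMx : IndepFun x M P)
    (hbal : Watermark.IsBalanced P s K x)
    (hnorm : ∀ᵐ ω ∂P, ‖s (M ω) (K ω) (x ω)‖ ^ 2 = (Fintype.card ι : ℝ))
    -- the noised watermarked sample
    (Xt : Ω → Watermark.Image ι)
    (hXt : ∀ ω, Xt ω =
      Watermark.forwardNoise β t (Watermark.embed γ s (M ω) (K ω) (x ω)) (ε ω)) :
    Watermark.mutualInfo P M Xt ≤
        ENNReal.ofReal ((Fintype.card ι : ℝ) / 2 *
          Real.log (1 + γ ^ 2 * Watermark.alphaBar β t / (1 - Watermark.alphaBar β t))) ∧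
      ∀ (pθ : 𝓨 → Kernel (Watermark.Image ι) 𝓞) (y : 𝓨) (Xout : Ω → 𝓞),
        IsMarkovKernel (pθ y) → Watermark.IsEditorOutput P M Xt (pθ y) Xout →
        Watermark.mutualInfo P M Xout ≤
          ENNReal.ofReal ((Fintype.card ι : ℝ) / 2 *
            Real.log (1 + γ ^ 2 * Watermark.alphaBar β t / (1 - Watermark.alphaBar β t))) := by
  obtain rfl : Xt = fun ω =>
      Watermark.forwardNoise β t (Watermark.embed γ s (M ω) (K ω) (x ω)) (ε ω) := funext hXt
  have hXt_meas : Measurable fun ω =>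
      Watermark.forwardNoise β t (Watermark.embed γ s (M ω) (K ω) (x ω)) (ε ω) := by
    have hsig : Measurable fun ω => s (M ω) (K ω) (x ω) := hs.comp (hM.prodMk (hK.prodMk hx))
    unfold Watermark.forwardNoise Watermark.embed
    fun_prop
  have hbound := Watermark.mutualInfo_forwardNoise_le hs γ hβ hα hM hK hx hε hεlaw hεindep hMx
    hnorm
  exact ⟨hbound, fun pθ y Xout _ hout =>
    (Watermark.mutualInfo_editorOutput_le P hM hXt_meas (pθ y) hout).trans hbound⟩
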